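/- Throughout, $\|\cdot\|$ is the spectral norm. For subspaces $\mathbb U,\mathbb V$ of a Euclidean space, the minimal principal angle $\theta\in[0,\pi/2]$ between them is given by $\cos\theta=\max\{\langle x,y\rangle: x\in\mathbb U,\ y\in\mathbb V,\ \|x\|\le 1,\ \|y\|\le 1\}$. (a) Let $M_1,M_2$ be real $L\times K$ matrices, let $\theta_{\min}$ be the minimal principal angle between their column spaces, and let $\sigma_i^{(\min)}$ be the minimal positive singular value of $M_i$ (with $\sigma_i^{(\min)}=0$ if $M_i=0$). Then $$\sigma_1^{(\min)}\sigma_2^{(\min)}\cos\theta_{\min}\ \le\ \|M_1^{\rm T}M_2\|\ \le\ \|M_1\|\,\|M_2\|\cos\theta_{\min}.$$ (b) Let $H,E$ be non-zero real $L\times K$ matrices with $d=\operatorname{rank}H<\min(L,K)$. Let $\mu_{\min}$ be the minimal positive and $\mu_{\max}$ the maximal eigenvalue of $HH^{\rm T}$, $\nu_{\max}=\|EE^{\rm T}\|$, $\Theta_1=\sqrt{\nu_{\max}/\mu_{\max}}$, $\Theta_2=\mu_{\max}/\mu_{\min}$. Let $S_0$ be the Moore-Penrose pseudoinverse of $HH^{\rm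 T}$, and $P_0^\perp$ the orthogonal projector onto the orthogonal complement of the kernel of $HH^{\rm T}$. For $\delta\in\mathbb R$ put $H(\delta)=H+\delta E$, $A(\delta)=H(\delta)H(\delta)^{\rm T}$ and $B(\delta)=\delta(HE^{\rm T}+EH^{\rm T})+\delta^2EE^{\rm T}$, so that $A(\delta)=HH^{\rm T}+B(\delta)$. Let $\theta_r$ (respectively $\theta_l$) be the minimal principal angle between the row spaces (respectively the column spaces) of $H$ and $E$. Suppose that $\delta_0>0$ and $\|B(\delta)\|/\mu_{\min}<1/4$ for all $\delta\in(-\delta_0,\delta_0)$. Then for every $\delta\in(-\delta_0,\delta_0)$ the subspace spanned by $d$ leading eigenvectors of $A(\delta)$ (equivalently, by $d$ leading left singular vectors of $H(\delta)$) is uniquely determined, and the orthogonal projector $P_0^\perp(\delta)$ onto it satisfies $$\big\|P_0^\perp(\delta)-P_0^\perp\big\|\ \le\ 4C\,\frac{\|S_0B(\delta)\|}{1-4\|B(\delta)\|/\mu_{\min}},\qquad C=\frac{e^{1/6}}{\sqrt\pi}.$$ Moreover, $$\|S_0B(\delta)\|\ \le\ |\delta|\,\Theta_1\Theta_2\big(2\cos\theta_r+|\delta|\,\Theta_1\cos\theta_l\big).$$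 -/

import Mathlib

open scoped Matrix
-- `‖M‖` for a matrix is its spectral norm: the operator norm for the Euclidean norms.
open scoped Matrix.Norms.L2Operator

namespace SignalSubspace

/-- The four Penrose equations: `X` is the pseudoinverse of the real matrix `M`. -/
def IsPseudoinverse {m n : ℕ} (M : Matrix (Fin m) (Fin n) ℝ) (X : Matrix (Fin n) (Fin m) ℝ) :
    Prop :=
  M * X * M = M ∧ X * M * X = X ∧ (M * X)ᵀ = M * X ∧ (X * M)ᵀ = X * M

theorem IsPseudoinverse.unique {m n : ℕ} {M : Matrix (Fin m) (Fin n) ℝ}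
    {X Y : Matrix (Fin n) (Fin m) ℝ} (hX : IsPseudoinverse M X) (hY : IsPseudoinverse M Y) :
    X = Y := by
  obtain ⟨x1, x2, x3, x4⟩ := hX
  obtain ⟨y1, y2, y3, y4⟩ := hY
  have h1 : M * X = M * Y := by
    calc M * X = (M * Y * M) * X := by rw [y1]
      _ = (M * Y) * (M * X) := by simp only [Matrix.mul_assoc]
      _ = (M * Y)ᵀ * (M * X)ᵀ := by rw [x3, y3]
      _ = ((M * X * M) * Y)ᵀ := by rw [← Matrix.transpose_mul]; simp only [Matrix.mul_assoc]
      _ = M * Y := by rw [x1, y3]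
  have h2 : X * M = Y * M := by
    calc X * M = X * (M * Y * M) := by rw [y1]
      _ = (X * M) * (Y * M) := by simp only [Matrix.mul_assoc]
      _ = (X * M)ᵀ * (Y * M)ᵀ := by rw [x4, y4]
      _ = (Y * (M * X * M))ᵀ := by rw [← Matrix.transpose_mul]; simp only [Matrix.mul_assoc]
      _ = Y * M := by rw [x1, y4]
  calc X = X * M * X := x2.symm
    _ = Y * (M * X) := by rw [h2, Matrix.mul_assoc]
    _ = Y * M * Y := by rw [h1, Matrix.mul_assoc]
    _ = Y := y2

theorem exists_isPseudoinverse_of_isHermitian {m : ℕ} {A : Matrix (Fin m) (Fin m) ℝ}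
    (hA : A.IsHermitian) : ∃ X, IsPseudoinverse A X ∧ Xᵀ = X := by
  set U : Matrix (Fin m) (Fin m) ℝ := (hA.eigenvectorUnitary).1 with hU
  have hUU : Uᵀ * U = 1 := by
    have := Unitary.coe_star_mul_self hA.eigenvectorUnitary
    simpa [Matrix.star_eq_conjTranspose, hU] using this
  have hspec : A = U * Matrix.diagonal hA.eigenvalues * Uᵀ := by
    have := hA.spectral_theorem
    simpa [Unitary.conjStarAlgAut_apply, Matrix.star_eq_conjTranspose, hU, Function.comp_def]
      using this
  generalize hA.eigenvalues = v at hspec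
  have key : ∀ D F : Matrix (Fin m) (Fin m) ℝ, (U * D * Uᵀ) * (U * F * Uᵀ) = U * (D * F) * Uᵀ := by
    intro D F
    calc (U * D * Uᵀ) * (U * F * Uᵀ) = U * D * (Uᵀ * U) * F * Uᵀ := by
          simp only [Matrix.mul_assoc]
      _ = U * (D * F) * Uᵀ := by rw [hUU]; simp only [Matrix.mul_assoc, Matrix.one_mul]
  have keyT : ∀ w : Fin m → ℝ, (U * Matrix.diagonal w * Uᵀ)ᵀ = U * Matrix.diagonal w * Uᵀ := by
    intro w
    simp [Matrix.transpose_mul, Matrix.mul_assoc]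
  refine ⟨U * Matrix.diagonal (fun i => (v i)⁻¹) * Uᵀ, ⟨?_, ?_, ?_, ?_⟩, keyT _⟩
  · rw [hspec]; simp only [key, Matrix.diagonal_mul_diagonal]
    congr 3; ext i; simp
  · rw [hspec]; simp only [key, Matrix.diagonal_mul_diagonal]
    congr 3; ext i
    by_cases h : v i = 0 <;> simp [h]
  · rw [hspec]; simp only [key, Matrix.diagonal_mul_diagonal, keyT]
  · rw [hspec]; simp only [key, Matrix.diagonal_mul_diagonal, keyT]

theorem exists_isPseudoinverse {m n : ℕ} (M : Matrix (Fin m) (Fin n) ℝ) :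
    ∃ X, IsPseudoinverse M X := by
  have hG : (M * Mᵀ).IsHermitian := by
    simpa using Matrix.isHermitian_mul_conjTranspose_self M
  obtain ⟨Y, ⟨y1, y2, y3, y4⟩, yT⟩ := exists_isPseudoinverse_of_isHermitian hG
  refine ⟨Mᵀ * Y, ?_, ?_, ?_, ?_⟩
  · set R := M * (Mᵀ * Y) * M - M with hR
    have hz : (M * Mᵀ * Y - 1) * (M * Mᵀ) = 0 := by rw [Matrix.sub_mul, y1]; simp
    have hR' : R = (M * Mᵀ * Y - 1) * M := by
      rw [hR, Matrix.sub_mul]; simp only [Matrix.mul_assoc, Matrix.one_mul]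
    have h0 : R * Rᵀ = 0 := by
      rw [hR', Matrix.transpose_mul]
      calc (M * Mᵀ * Y - 1) * M * (Mᵀ * (M * Mᵀ * Y - 1)ᵀ)
          = ((M * Mᵀ * Y - 1) * (M * Mᵀ)) * (M * Mᵀ * Y - 1)ᵀ := by
            simp only [Matrix.mul_assoc]
        _ = 0 := by rw [hz, Matrix.zero_mul]
    have : R = 0 := by
      apply Matrix.self_mul_conjTranspose_eq_zero.mp
      simpa using h0
    exact sub_eq_zero.mp this
  · calc Mᵀ * Y * M * (Mᵀ * Y) = Mᵀ * (Y * (M * Mᵀ) * Y) := by simp only [Matrix.mul_assoc]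
      _ = Mᵀ * Y := by rw [y2]
  · rw [← Matrix.mul_assoc]; exact y3
  · simp [Matrix.transpose_mul, yT, Matrix.mul_assoc]

/-- The Moore-Penrose pseudoinverse of a real matrix. -/
noncomputable def pinv {m n : ℕ} (M : Matrix (Fin m) (Fin n) ℝ) : Matrix (Fin n) (Fin m) ℝ :=
  Classical.choose (exists_isPseudoinverse M)

theorem isPseudoinverse_pinv {m n : ℕ} (M : Matrix (Fin m) (Fin n) ℝ) :
    IsPseudoinverse M (pinv M) :=
  Classical.choose_spec (exists_isPseudoinverse M)

/-- The subspace of `ℝ^m` spanned by the columns of `M`. -/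
def colSpace {m n : ℕ} (M : Matrix (Fin m) (Fin n) ℝ) : Submodule ℝ (EuclideanSpace ℝ (Fin m)) :=
  Submodule.span ℝ (Set.range fun j : Fin n => WithLp.toLp 2 (fun i => M i j))

/-- The subspace of `ℝ^n` spanned by the rows of `M`. -/
def rowSpace {m n : ℕ} (M : Matrix (Fin m) (Fin n) ℝ) : Submodule ℝ (EuclideanSpace ℝ (Fin n)) :=
  Submodule.span ℝ (Set.range fun i : Fin m => WithLp.toLp 2 (fun j => M i j))

/-- The minimal principal angle between two subspaces: its cosine is the maximum of `⟪x, y⟫` over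
`x ∈ U`, `y ∈ V` of norm at most one. -/
noncomputable def minAngle {n : ℕ} (U V : Submodule ℝ (EuclideanSpace ℝ (Fin n))) : ℝ :=
  Real.arccos (sSup {c : ℝ | ∃ x ∈ U, ∃ y ∈ V, ‖x‖ ≤ 1 ∧ ‖y‖ ≤ 1 ∧ c = inner ℝ x y})

/-- The minimal positive singular value (that is, the minimal one of those that occur in
`M = ∑ σ_j u_j v_jᵀ` with `(u_j)` an orthonormal basis of the column space); `0` for `M = 0`. -/
noncomputable def minSingularValue {m n : ℕ} (M : Matrix (Fin m) (Fin n) ℝ) : ℝ :=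
  sInf {s : ℝ | 0 < s ∧ ∃ i : ℕ, (Matrix.toEuclideanLin M).singularValues i = s}

/-- The set of (real) eigenvalues of a square matrix. -/
def eigenvalueSet {m : ℕ} (A : Matrix (Fin m) (Fin m) ℝ) : Set ℝ :=
  {t : ℝ | Module.End.HasEigenvalue (Matrix.toEuclideanLin A) t}

/-- The minimal positive eigenvalue. -/
noncomputable def minPosEigenvalue {m : ℕ} (A : Matrix (Fin m) (Fin m) ℝ) : ℝ :=
  sInf {t | t ∈ eigenvalueSet A ∧ 0 < t}

/-- The maximal eigenvalue. -/
noncomputable def maxEigenvalue {m : ℕ} (A : Matrix (Fin m) (Fin m) ℝ) : ℝ :=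
  sSup (eigenvalueSet A)

section Perturbation

variable {L K : ℕ} (H E : Matrix (Fin L) (Fin K) ℝ)

/-- `A(δ) = H(δ) H(δ)ᵀ` with `H(δ) = H + δ E`. -/
def pertA (δ : ℝ) : Matrix (Fin L) (Fin L) ℝ := (H + δ • E) * (H + δ • E)ᵀ

/-- `B(δ) = δ (H Eᵀ + E Hᵀ) + δ² E Eᵀ`, so that `A(δ) = H Hᵀ + B(δ)`. -/
def pertB (δ : ℝ) : Matrix (Fin L) (Fin L) ℝ := δ • (H * Eᵀ + E * Hᵀ) + δ ^ 2 • (E * Eᵀ)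

/-- `μ_min`, the minimal positive eigenvalue of `H Hᵀ`. -/
noncomputable def muMin : ℝ := minPosEigenvalue (H * Hᵀ)

/-- `μ_max`, the maximal eigenvalue of `H Hᵀ`. -/
noncomputable def muMax : ℝ := maxEigenvalue (H * Hᵀ)

/-- `ν_max = ‖E Eᵀ‖`. -/
noncomputable def nuMax : ℝ := ‖E * Eᵀ‖

/-- `Θ₁ = √(ν_max / μ_max)`. -/
noncomputable def Theta1 : ℝ := √(nuMax E / muMax H)

/-- `Θ₂ = μ_max / μ_min`. -/
noncomputable def Theta2 : ℝ := muMax H / muMin H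

/-- `S₀`, the pseudoinverse of `H Hᵀ`. -/
noncomputable def S0 : Matrix (Fin L) (Fin L) ℝ := pinv (H * Hᵀ)

/-- `U₀`, the eigenspace of `H Hᵀ` for the eigenvalue zero. -/
noncomputable def U0 : Submodule ℝ (EuclideanSpace ℝ (Fin L)) :=
  Module.End.eigenspace (Matrix.toEuclideanLin (H * Hᵀ)) 0

end Perturbation

/-- `U` is spanned by the `d` leading eigenvectors of the symmetric matrix `A`: by the first `d`
vectors of some orthonormal eigenbasis ordered by decreasing eigenvalues. -/
def IsLeadingSubspace {m : ℕ} (A : Matrix (Fin m) (Fin m) ℝ) (d : ℕ)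
    (U : Submodule ℝ (EuclideanSpace ℝ (Fin m))) : Prop :=
  ∃ (b : OrthonormalBasis (Fin m) ℝ (EuclideanSpace ℝ (Fin m))) (lam : Fin m → ℝ),
    Antitone lam ∧ (∀ i, Matrix.toEuclideanLin A (b i) = lam i • b i) ∧
      U = Submodule.span ℝ (b '' {i | (i : ℕ) < d})

end SignalSubspace

/-! Part (a), upper bound: with `z = M₁ᵀ M₂ y` one has `‖z‖² = ⟪M₁ z, M₂ y⟫`, an inner product of
vectors from the two column spaces, so the cosine enters directly. Lower bound: vectors of the
column spaces are lifted to preimages orthogonal to the kernels, where `M` expands by at least its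
minimal positive singular value.

Part (b) needs no perturbation series; a self-bounding `sin θ` argument gives a stronger estimate.
Let `V = (ker HHᵀ)ᗮ`, let `U` be the leading subspace of `A = A(δ)`, and write `B = B(δ)`, `β =
‖B‖`, `μ = μ_min`. Dimension counting (Weyl) puts the trailing eigenvalues of `A` in `[0, β]` and
the leading ones above `μ - β`; since `2β < μ`, `U` is unique. On `Uᗮ`, the identity `P_V = S₀ HHᵀ =
S₀ A - S₀ B` is combined with `‖S₀ w‖ ≤ μ⁻¹ ‖P_V w‖`. As `Uᗮ` is `A`-invariant, `X = P_V P_{Uᗮ}`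
reappears on the right: `‖X‖ ≤ (β/μ) ‖X‖ + ‖S₀ B‖`. Since `dim U = dim V`, `‖P_U - P_V‖ ≤ ‖X‖`
(`norm_starProjection_sub_le`), whence the bound `‖S₀ B‖ / (1 - β/μ)` of
`norm_starProjection_leading_sub_le`. The stated bound is weaker because `4C ≥ 1` and `1 - 4β/μ ≤ 1
- β/μ`.

The estimate of `‖S₀ B‖` applies (a) to `H Eᵀ` (row spaces) and to `S₀ E` (column spaces). -/

namespace SignalSubspace

/-! ### Gaps between subspaces and differences of orthogonal projections -/

section Projections

variable {E : Type*} [NormedAddCommGroup E] [InnerProductSpace ℝ E] [FiniteDimensional ℝ E]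

theorem inner_sub_starProjection_eq_zero (U : Submodule ℝ E) {y : E} (hy : y ∈ U) (x : E) :
    inner ℝ y (x - U.starProjection x) = 0 :=
  Submodule.inner_right_of_mem_orthogonal hy (U.sub_starProjection_mem_orthogonal x)

theorem inner_starProjection_right_of_mem (U : Submodule ℝ E) {y : E} (hy : y ∈ U) (x : E) :
    inner ℝ y (U.starProjection x) = inner ℝ y x := by
  have := inner_sub_starProjection_eq_zero U hy x
  rw [inner_sub_right] at this
  linarith

theorem norm_sq_eq_add_starProjection (U : Submodule ℝ E) (x : E) :
    ‖x‖ ^ 2 = ‖U.starProjection x‖ ^ 2 + ‖x - U.starProjection x‖ ^ 2 := by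
  have h := inner_sub_starProjection_eq_zero U (U.starProjection_apply_mem x) x
  have := norm_add_sq_eq_norm_sq_add_norm_sq_of_inner_eq_zero _ _ h
  rw [add_sub_cancel] at this
  nlinarith

/-- The difference of two orthogonal projections is controlled by the two one-sided gaps. -/
theorem norm_starProjection_sub_le_of_gaps {U V : Submodule ℝ E} {s : ℝ} (hs : 0 ≤ s)
    (hV : ∀ x ∈ V, ‖x - U.starProjection x‖ ≤ s * ‖x‖)
    (hU : ∀ y ∈ U, ‖y - V.starProjection y‖ ≤ s * ‖y‖) :
    ‖U.starProjection - V.starProjection‖ ≤ s := by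
  refine ContinuousLinearMap.opNorm_le_bound _ hs fun x => ?_
  set p := V.starProjection x with hp
  set z := x - p with hz
  have hpV : p ∈ V := V.starProjection_apply_mem x
  have hqU : U.starProjection z ∈ U := U.starProjection_apply_mem z
  -- The two pieces lie in `U` and `Uᗮ`, so their squared norms add; they are bounded through `p`
  -- and `z`, whose squared norms also add.
  have hdec : (U.starProjection - V.starProjection) x
      = U.starProjection z - (p - U.starProjection p) := by
    simp only [sub_apply, hz, map_sub]
    abel
  have horth : inner ℝ (U.starProjection z) (p - U.starProjection p) = 0 :=
    inner_sub_starProjection_eq_zero U hqU p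
  have hnorm : ‖(U.starProjection - V.starProjection) x‖ ^ 2
      = ‖U.starProjection z‖ ^ 2 + ‖p - U.starProjection p‖ ^ 2 := by
    rw [hdec, norm_sub_sq_real, horth]
    ring
  have h1 : ‖p - U.starProjection p‖ ≤ s * ‖p‖ := hV p hpV
  have h2 : ‖U.starProjection z‖ ≤ s * ‖z‖ := by
    set q := U.starProjection z with hq
    have hzV : z ∈ Vᗮ := V.sub_starProjection_mem_orthogonal x
    have e1 : ‖q‖ ^ 2 = inner ℝ q z := by
      rw [← inner_starProjection_right_of_mem U hqU z, ← hq, real_inner_self_eq_norm_sq]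
    -- Since `z ⊥ V`, only the part of `q` outside `V` counts, and the gap of `U` bounds it.
    have e2 : inner ℝ q z = inner ℝ (q - V.starProjection q) z := by
      rw [inner_sub_left, Submodule.inner_right_of_mem_orthogonal
        (V.starProjection_apply_mem q) hzV, sub_zero]
    have e3 := real_inner_le_norm (q - V.starProjection q) z
    have e4 := hU q hqU
    have e5 : ‖q‖ * ‖q‖ ≤ ‖q‖ * (s * ‖z‖) := by
      nlinarith [mul_le_mul_of_nonneg_right e4 (norm_nonneg z)]
    rcases (norm_nonneg q).eq_or_lt with h0 | h0
    · rw [← h0]; positivity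
    · exact le_of_mul_le_mul_left e5 h0
  have h3 := norm_sq_eq_add_starProjection V x
  have h4 : ‖(U.starProjection - V.starProjection) x‖ ^ 2 ≤ (s * ‖x‖) ^ 2 := by
    rw [hnorm, mul_pow, h3]
    have a1 := pow_le_pow_left₀ (norm_nonneg _) h1 2
    have a2 := pow_le_pow_left₀ (norm_nonneg _) h2 2
    rw [mul_pow] at a1 a2
    rw [← hp, ← hz]
    linarith
  exact le_of_sq_le_sq h4 (by positivity)

/-- For subspaces of equal dimension, one one-sided gap controls the other one. -/
theorem gap_symm {U V : Submodule ℝ E} (hd : Module.finrank ℝ V = Module.finrank ℝ U) {s : ℝ}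
    (hs : 0 ≤ s) (hV : ∀ x ∈ V, ‖x - U.starProjection x‖ ≤ s * ‖x‖) :
    ∀ y ∈ U, ‖y - V.starProjection y‖ ≤ s * ‖y‖ := by
  intro y hy
  have hpy := norm_sq_eq_add_starProjection V y
  rcases le_or_gt 1 s with h1 | h1
  · have : ‖y - V.starProjection y‖ ≤ ‖y‖ :=
      le_of_sq_le_sq (by nlinarith [sq_nonneg ‖V.starProjection y‖]) (norm_nonneg _)
    nlinarith [norm_nonneg y]
  -- For `s < 1` the projection `V → U` is injective, hence onto by equality of dimensions, so `y =
  -- P_U v` with `v ∈ V`. Then `⟪v, P_V y⟫ = ‖y‖²` and `(1 - s²) ‖v‖² ≤ ‖y‖²` bound `‖P_V y‖` from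
  -- below.
  let f : V →ₗ[ℝ] U := U.orthogonalProjectionOnto.toLinearMap ∘ₗ V.subtype
  have hf : ∀ v : V, ((f v : U) : E) = U.starProjection v := fun v => rfl
  have hinj : Function.Injective f := by
    rw [injective_iff_map_eq_zero]
    intro v hv
    have h0 : U.starProjection (v : E) = 0 := by rw [← hf, hv]; rfl
    have := hV v v.2
    rw [h0, sub_zero] at this
    have : ‖(v : E)‖ = 0 := by nlinarith [norm_nonneg (v : E)]
    simpa using this
  have hsurj : Function.Surjective f := (LinearMap.injective_iff_surjective_of_finrank_eq_finrank
    hd).mp hinj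
  obtain ⟨⟨v, hvV⟩, hv⟩ := hsurj ⟨y, hy⟩
  have hvy : U.starProjection v = y := by
    rw [← hf ⟨v, hvV⟩, hv]
  have a1 := norm_sq_eq_add_starProjection U v
  have a2 := hV v hvV
  rw [hvy] at a1 a2
  have a3 : inner ℝ y v = ‖y‖ ^ 2 := by
    rw [← inner_starProjection_right_of_mem U hy v, hvy, real_inner_self_eq_norm_sq]
  have a4 : inner ℝ v (V.starProjection y) = ‖y‖ ^ 2 := by
    rw [inner_starProjection_right_of_mem V hvV y, real_inner_comm, a3]
  have a5 : ‖y‖ ^ 2 ≤ ‖v‖ * ‖V.starProjection y‖ := a4 ▸ real_inner_le_norm _ _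
  have a6 := pow_le_pow_left₀ (norm_nonneg _) a2 2
  have a7 := pow_le_pow_left₀ (by positivity) a5 2
  rw [mul_pow] at a6 a7
  have hs2 : 0 < 1 - s ^ 2 := by nlinarith
  refine le_of_sq_le_sq ?_ (by positivity)
  rcases (norm_nonneg y).eq_or_lt with h0 | h0
  · have : y = 0 := by simpa using h0.symm
    simp [this]
  have a8 : ‖y‖ ^ 2 * ((1 - s ^ 2) * ‖y‖ ^ 2) ≤ ‖y‖ ^ 2 * ‖V.starProjection y‖ ^ 2 := by
    have b1 := mul_le_mul_of_nonneg_left a7 hs2.le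
    have b2 : (1 - s ^ 2) * ‖v‖ ^ 2 ≤ ‖y‖ ^ 2 := by linarith
    have b3 := mul_le_mul_of_nonneg_right b2 (sq_nonneg ‖V.starProjection y‖)
    nlinarith
  have a9 := le_of_mul_le_mul_left a8 (by positivity)
  rw [mul_pow]
  linarith

/-- The maps `P_V P_{Uᗮ}` and `P_{Uᗮ} P_V` are adjoint, so the hypothesis bounds the gap of `V` from
`U`; equal dimensions supply the reverse gap. -/
theorem norm_starProjection_sub_le {U V : Submodule ℝ E}
    (hd : Module.finrank ℝ V = Module.finrank ℝ U) {s : ℝ} (hs : 0 ≤ s)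
    (h : ∀ v ∈ Uᗮ, ‖V.starProjection v‖ ≤ s * ‖v‖) :
    ‖U.starProjection - V.starProjection‖ ≤ s := by
  have hV : ∀ x ∈ V, ‖x - U.starProjection x‖ ≤ s * ‖x‖ := by
    intro x hx
    set w := x - U.starProjection x with hw
    have hwU : w ∈ Uᗮ := U.sub_starProjection_mem_orthogonal x
    have e1 : ‖w‖ ^ 2 = inner ℝ x w := by
      have : inner ℝ w w = inner ℝ x w - inner ℝ (U.starProjection x) w := by
        rw [← inner_sub_left]
      rw [Submodule.inner_right_of_mem_orthogonal (U.starProjection_apply_mem x) hwU] at this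
      rw [← real_inner_self_eq_norm_sq, this, sub_zero]
    have e2 : inner ℝ x w ≤ ‖x‖ * ‖V.starProjection w‖ := by
      rw [← inner_starProjection_right_of_mem V hx w]
      exact real_inner_le_norm _ _
    have e3 := mul_le_mul_of_nonneg_left (h w hwU) (norm_nonneg x)
    rcases (norm_nonneg w).eq_or_lt with h0 | h0
    · rw [← h0]; positivity
    · exact le_of_mul_le_mul_left (by nlinarith) h0
  exact norm_starProjection_sub_le_of_gaps hs hV (gap_symm hd hs hV)

end Projections

/-! ### Eigenbases, quadratic forms and spectral gaps -/

section Spectral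

variable {E : Type*} [NormedAddCommGroup E] [InnerProductSpace ℝ E]

theorem inner_map_eq_mul {m : ℕ} {T : E →ₗ[ℝ] E} {b : OrthonormalBasis (Fin m) ℝ E}
    {lam : Fin m → ℝ} (hT : T.IsSymmetric) (hb : ∀ i, T (b i) = lam i • b i) (v : E) (i : Fin m) :
    inner ℝ (b i) (T v) = lam i * inner ℝ (b i) v := by
  rw [← hT, hb, inner_smul_left]
  simp

theorem inner_map_self_eq_sum {m : ℕ} {T : E →ₗ[ℝ] E} {b : OrthonormalBasis (Fin m) ℝ E}
    {lam : Fin m → ℝ} (hT : T.IsSymmetric) (hb : ∀ i, T (b i) = lam i • b i) (v : E) :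
    inner ℝ v (T v) = ∑ i, lam i * inner ℝ (b i) v ^ 2 := by
  rw [← b.sum_inner_mul_inner v (T v)]
  refine Finset.sum_congr rfl fun i _ => ?_
  rw [inner_map_eq_mul hT hb, real_inner_comm]
  ring

theorem norm_sq_eq_sum_inner {m : ℕ} (b : OrthonormalBasis (Fin m) ℝ E) (v : E) :
    ‖v‖ ^ 2 = ∑ i, inner ℝ (b i) v ^ 2 := by
  rw [← b.sum_sq_norm_inner_right v]
  simp

theorem inner_eq_zero_of_mem_span {m : ℕ} (b : OrthonormalBasis (Fin m) ℝ E) {s : Set (Fin m)}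
    {v : E} (hv : v ∈ Submodule.span ℝ (b '' s)) {i : Fin m} (hi : i ∉ s) :
    inner ℝ (b i) v = 0 := by
  induction hv using Submodule.span_induction with
  | mem x hx =>
    obtain ⟨j, hj, rfl⟩ := hx
    exact b.orthonormal.2 fun h => hi (h ▸ hj)
  | zero => simp
  | add x y _ _ hx hy => rw [inner_add_right, hx, hy, add_zero]
  | smul a x _ hx => rw [inner_smul_right, hx, mul_zero]

theorem mem_span_of_inner_eq_zero {m : ℕ} (b : OrthonormalBasis (Fin m) ℝ E) {s : Set (Fin m)}
    {v : E} (hv : ∀ i ∉ s, inner ℝ (b i) v = 0) : v ∈ Submodule.span ℝ (b '' s) := by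
  rw [← b.sum_repr' v]
  refine Submodule.sum_mem _ fun i _ => ?_
  by_cases hi : i ∈ s
  · exact Submodule.smul_mem _ _ (Submodule.subset_span ⟨i, hi, rfl⟩)
  · rw [hv i hi, zero_smul]
    exact Submodule.zero_mem _

theorem finrank_span_image {m : ℕ} (b : OrthonormalBasis (Fin m) ℝ E) (s : Finset (Fin m)) :
    Module.finrank ℝ (Submodule.span ℝ (b '' (s : Set (Fin m)))) = s.card := by
  have hli : LinearIndependent ℝ (fun i : s => b i) :=
    b.orthonormal.linearIndependent.comp _ Subtype.val_injective
  have := finrank_span_eq_card hli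
  have hr : Set.range (fun i : s => b i) = b '' (s : Set (Fin m)) := by
    ext x; simp
  rw [hr] at this
  simpa using this

/-- A spectral gap makes the span of the leading eigenvectors independent of the eigenbasis. -/
theorem span_leading_eq {m : ℕ} {T : E →ₗ[ℝ] E} {b : OrthonormalBasis (Fin m) ℝ E}
    {lam : Fin m → ℝ} (hT : T.IsSymmetric)
    (hb : ∀ i, T (b i) = lam i • b i) {d : ℕ} {γ : ℝ}
    (hlow : ∀ i : Fin m, d ≤ i → lam i < γ) (hhigh : ∀ i : Fin m, i < d → γ ≤ lam i) :
    Submodule.span ℝ (b '' {i | (i : ℕ) < d}) =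
      Submodule.span ℝ {v | ∃ t, γ ≤ t ∧ T v = t • v} := by
  refine le_antisymm (Submodule.span_mono ?_) (Submodule.span_le.mpr ?_)
  · rintro _ ⟨i, hi, rfl⟩
    exact ⟨lam i, hhigh i hi, hb i⟩
  · rintro v ⟨t, ht, hv⟩
    refine mem_span_of_inner_eq_zero b fun i hi => ?_
    have h1 := inner_map_eq_mul hT hb v i
    rw [hv, inner_smul_right] at h1
    have h2 := hlow i (by simpa using hi)
    -- Eigenvectors for the distinct eigenvalues `t ≥ γ > lam i` are orthogonal.
    have h3 : (t - lam i) * inner ℝ (b i) v = 0 := by linarith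
    exact (mul_eq_zero.mp h3).resolve_left (by linarith)

variable [FiniteDimensional ℝ E]

theorem exists_mem_inf_ne_zero {U V : Submodule ℝ E}
    (h : Module.finrank ℝ E < Module.finrank ℝ U + Module.finrank ℝ V) :
    ∃ v, v ∈ U ∧ v ∈ V ∧ v ≠ 0 := by
  have h1 := Submodule.finrank_sup_add_finrank_inf_eq U V
  have h2 := Submodule.finrank_le (U ⊔ V)
  have h3 : U ⊓ V ≠ ⊥ := by
    intro h0
    rw [h0, finrank_bot] at h1
    omega
  obtain ⟨v, hv, hv0⟩ := Submodule.exists_mem_ne_zero_of_ne_bot h3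
  exact ⟨v, hv.1, hv.2, hv0⟩

/-- In an eigenbasis, the directions with eigenvalue zero contribute nothing, because `v` is
orthogonal to the kernel. -/
theorem mul_norm_sq_le_inner_map {T : E →ₗ[ℝ] E} (hT : T.IsSymmetric) {μ : ℝ}
    (hμ : ∀ t, Module.End.HasEigenvalue T t → t = 0 ∨ μ ≤ t) {v : E}
    (hv : v ∈ (LinearMap.ker T)ᗮ) : μ * ‖v‖ ^ 2 ≤ inner ℝ v (T v) := by
  set b := hT.eigenvectorBasis rfl
  have hb : ∀ i, T (b i) = hT.eigenvalues rfl i • b i := hT.apply_eigenvectorBasis rfl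
  rw [inner_map_self_eq_sum hT hb, norm_sq_eq_sum_inner b, Finset.mul_sum]
  refine Finset.sum_le_sum fun i _ => ?_
  rcases hμ _ (hT.hasEigenvalue_eigenvalues rfl i) with h | h
  · have h0 : b i ∈ LinearMap.ker T := by
      rw [LinearMap.mem_ker, hb, show hT.eigenvalues rfl i = 0 from h, zero_smul]
    rw [Submodule.inner_right_of_mem_orthogonal h0 hv]
    simp
  · exact mul_le_mul_of_nonneg_right h (sq_nonneg _)

theorem inner_map_le_mul_norm_sq {T : E →ₗ[ℝ] E} (hT : T.IsSymmetric) {μ : ℝ}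
    (hμ : ∀ t, Module.End.HasEigenvalue T t → t ≤ μ) (v : E) :
    inner ℝ v (T v) ≤ μ * ‖v‖ ^ 2 := by
  set b := hT.eigenvectorBasis rfl
  have hb : ∀ i, T (b i) = hT.eigenvalues rfl i • b i := hT.apply_eigenvectorBasis rfl
  rw [inner_map_self_eq_sum hT hb, norm_sq_eq_sum_inner b, Finset.mul_sum]
  exact Finset.sum_le_sum fun i _ =>
    mul_le_mul_of_nonneg_right (hμ _ (hT.hasEigenvalue_eigenvalues rfl i)) (sq_nonneg _)

theorem ker_orthogonal_eq_range {T : E →ₗ[ℝ] E} (hT : T.IsSymmetric) :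
    (LinearMap.ker T)ᗮ = LinearMap.range T := by
  rw [← hT.orthogonal_range, Submodule.orthogonal_orthogonal]

/-! ### Weyl-type eigenvalue bounds and the `sin θ` estimate -/

section Perturbed

variable {T₀ T : E →ₗ[ℝ] E} {μ β : ℝ} {m : ℕ} {b : OrthonormalBasis (Fin m) ℝ E}
  {lam : Fin m → ℝ}

theorem eigenvalue_le_of_finrank_range_le (hT : T.IsSymmetric)
    (hβ : ∀ v, |inner ℝ v ((T - T₀) v)| ≤ β * ‖v‖ ^ 2)
    (hlam : Antitone lam) (hb : ∀ i, T (b i) = lam i • b i) {i : Fin m}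
    (hi : Module.finrank ℝ (LinearMap.range T₀) ≤ i) : lam i ≤ β := by
  have hm : Module.finrank ℝ E = m := by simpa using Module.finrank_eq_card_basis b.toBasis
  have h1 := finrank_span_image b (Finset.Iic i)
  have h2 := T₀.finrank_range_add_finrank_ker
  rw [Fin.card_Iic] at h1
  -- The first `i + 1` eigenvectors of `T` span too much to avoid `ker T₀`, of dimension `m - rank
  -- T₀ ≥ m - i`. On a common vector the form of `T` is that of the perturbation alone.
  obtain ⟨v, hv1, hv2, hv0⟩ := exists_mem_inf_ne_zero (E := E)
    (U := Submodule.span ℝ (b '' (Finset.Iic i : Finset (Fin m)))) (V := LinearMap.ker T₀)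
    (by omega)
  have h3 := inner_map_self_eq_sum hT hb v
  have h4 : lam i * ‖v‖ ^ 2 ≤ inner ℝ v (T v) := by
    rw [h3, norm_sq_eq_sum_inner b, Finset.mul_sum]
    refine Finset.sum_le_sum fun j _ => ?_
    by_cases hj : j ≤ i
    · exact mul_le_mul_of_nonneg_right (hlam hj) (sq_nonneg _)
    · rw [inner_eq_zero_of_mem_span b hv1 (by simpa using hj)]
      simp
  have h5 := (abs_le.mp (hβ v)).2
  rw [LinearMap.sub_apply, LinearMap.mem_ker.mp hv2, sub_zero] at h5
  exact le_of_mul_le_mul_right (h4.trans h5) (by positivity)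

theorem le_eigenvalue_of_lt_finrank_range (hT₀ : T₀.IsSymmetric) (hT : T.IsSymmetric)
    (hμ : ∀ v ∈ (LinearMap.ker T₀)ᗮ, μ * ‖v‖ ^ 2 ≤ inner ℝ v (T₀ v))
    (hβ : ∀ v, |inner ℝ v ((T - T₀) v)| ≤ β * ‖v‖ ^ 2)
    (hlam : Antitone lam) (hb : ∀ i, T (b i) = lam i • b i) {i : Fin m}
    (hi : i < Module.finrank ℝ (LinearMap.range T₀)) : μ - β ≤ lam i := by
  have hm : Module.finrank ℝ E = m := by simpa using Module.finrank_eq_card_basis b.toBasis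
  have h1 := finrank_span_image b (Finset.Ici i)
  rw [Fin.card_Ici] at h1
  have h2 := ker_orthogonal_eq_range hT₀
  -- Dual count: the last `m - i` eigenvectors of `T` against `(ker T₀)ᗮ`, of dimension at least `i
  -- + 1`.
  obtain ⟨v, hv1, hv2, hv0⟩ := exists_mem_inf_ne_zero (E := E)
    (U := Submodule.span ℝ (b '' (Finset.Ici i : Finset (Fin m)))) (V := (LinearMap.ker T₀)ᗮ)
    (by rw [h2]; omega)
  have h3 := inner_map_self_eq_sum hT hb v
  have h4 : inner ℝ v (T v) ≤ lam i * ‖v‖ ^ 2 := by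
    rw [h3, norm_sq_eq_sum_inner b, Finset.mul_sum]
    refine Finset.sum_le_sum fun j _ => ?_
    by_cases hj : i ≤ j
    · exact mul_le_mul_of_nonneg_right (hlam hj) (sq_nonneg _)
    · rw [inner_eq_zero_of_mem_span b hv1 (by simpa using hj)]
      simp
  have h5 := (abs_le.mp (hβ v)).1
  have h6 := hμ v hv2
  rw [LinearMap.sub_apply, inner_sub_right] at h5
  refine le_of_mul_le_mul_right (a := ‖v‖ ^ 2) ?_ (by positivity)
  nlinarith

/-- The `sin θ` bound: the leading eigenspace of a positive operator `T` is compared with the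
range of `T₀` through a reduced inverse `S` of `T₀`. -/
theorem norm_starProjection_leading_sub_le (hT₀ : T₀.IsSymmetric) (hT : T.IsPositive)
    (hμ0 : 0 < μ) (hβμ : β < μ) (hβ0 : 0 ≤ β)
    (hβ : ∀ v, |inner ℝ v ((T - T₀) v)| ≤ β * ‖v‖ ^ 2)
    (hlam : Antitone lam) (hb : ∀ i, T (b i) = lam i • b i)
    {S : E →ₗ[ℝ] E} {η : ℝ} (hST : ∀ v, S (T₀ v) = (LinearMap.ker T₀)ᗮ.starProjection v)
    (hSP : ∀ v, ‖S v‖ ≤ μ⁻¹ * ‖(LinearMap.ker T₀)ᗮ.starProjection v‖)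
    (hη0 : 0 ≤ η) (hη : ∀ v, ‖S ((T - T₀) v)‖ ≤ η * ‖v‖) :
    ‖(Submodule.span ℝ (b '' {i | (i : ℕ) < Module.finrank ℝ (LinearMap.range T₀)})).starProjection
      - (LinearMap.ker T₀)ᗮ.starProjection‖ ≤ η / (1 - β / μ) := by
  set d := Module.finrank ℝ (LinearMap.range T₀) with hd
  set U := Submodule.span ℝ (b '' {i | (i : ℕ) < d}) with hU
  set V := (LinearMap.ker T₀)ᗮ with hV
  have hm : Module.finrank ℝ E = m := by simpa using Module.finrank_eq_card_basis b.toBasis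
  have hdm : d ≤ m := hm ▸ Submodule.finrank_le _
  have hUd : Module.finrank ℝ U = d := by
    have h1 := finrank_span_image b (Finset.univ.filter fun i : Fin m => (i : ℕ) < d)
    rw [Fin.card_filter_val_lt, Finset.coe_filter_univ, min_eq_right hdm] at h1
    exact h1
  have hVd : Module.finrank ℝ V = d := by rw [hV, ker_orthogonal_eq_range hT₀]
  have hortho : ∀ v ∈ Uᗮ, ∀ i : Fin m, (i : ℕ) < d → inner ℝ (b i) v = 0 := fun v hv i hi =>
    Submodule.inner_right_of_mem_orthogonal (Submodule.subset_span (Set.mem_image_of_mem b hi)) hv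
  have hTU : ∀ v ∈ Uᗮ, T v ∈ Uᗮ := by
    intro v hv
    rw [Submodule.mem_orthogonal]
    intro u hu
    rw [← hT.isSymmetric]
    refine Submodule.inner_right_of_mem_orthogonal (K := U) ?_ hv
    refine mem_span_of_inner_eq_zero b fun i hi => ?_
    rw [inner_map_eq_mul hT.isSymmetric hb, inner_eq_zero_of_mem_span b hu hi, mul_zero]
  have hTn : ∀ v ∈ Uᗮ, ‖T v‖ ≤ β * ‖v‖ := by
    intro v hv
    refine le_of_sq_le_sq ?_ (by positivity)
    rw [mul_pow, norm_sq_eq_sum_inner b, norm_sq_eq_sum_inner b, Finset.mul_sum]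
    refine Finset.sum_le_sum fun i _ => ?_
    rw [inner_map_eq_mul hT.isSymmetric hb]
    rcases lt_or_ge (i : ℕ) d with hi | hi
    · simp [hortho v hv i hi]
    · have h1 := eigenvalue_le_of_finrank_range_le hT.isSymmetric hβ hlam hb hi
      -- Positivity of `T` turns the one-sided bound `lam i ≤ β` into a bound on `lam i ^ 2`.
      have h2 : 0 ≤ lam i := by
        have := hT.inner_nonneg_right (b i)
        rw [hb, inner_smul_right, real_inner_self_eq_norm_sq, b.orthonormal.1] at this
        simpa using this
      rw [mul_pow]
      exact mul_le_mul_of_nonneg_right (pow_le_pow_left₀ h2 h1 2) (sq_nonneg _)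
  set X := V.starProjection ∘L Uᗮ.starProjection with hX
  have hXv : ∀ v ∈ Uᗮ, ‖V.starProjection v‖ ≤ ‖X‖ * ‖v‖ := by
    intro v hv
    have := X.le_opNorm v
    rwa [hX, ContinuousLinearMap.comp_apply, Submodule.starProjection_eq_self_iff.mpr hv] at this
  have hstep : ∀ v ∈ Uᗮ, ‖V.starProjection v‖ ≤ (μ⁻¹ * (‖X‖ * β) + η) * ‖v‖ := by
    intro v hv
    have e : V.starProjection v = S (T v) - S ((T - T₀) v) := by
      rw [← hST, ← map_sub]
      simp
    rw [e]
    refine (norm_sub_le _ _).trans ?_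
    -- The self-bounding step: `T v` is again in `Uᗮ`, so `‖X‖` controls its projection to `V`. This
    -- is why `hSP` keeps the projection on its right side.
    have h1 : ‖V.starProjection (T v)‖ ≤ ‖X‖ * (β * ‖v‖) :=
      (hXv _ (hTU v hv)).trans (mul_le_mul_of_nonneg_left (hTn v hv) (norm_nonneg _))
    have h2 := mul_le_mul_of_nonneg_left h1 (inv_nonneg.mpr hμ0.le)
    nlinarith [hSP (T v), hη v]
  have hXn : ‖X‖ ≤ μ⁻¹ * (‖X‖ * β) + η := by
    refine ContinuousLinearMap.opNorm_le_bound _ (by positivity) fun v => ?_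
    rw [hX, ContinuousLinearMap.comp_apply]
    refine (hstep _ (Uᗮ.starProjection_apply_mem v)).trans ?_
    exact mul_le_mul_of_nonneg_left (Uᗮ.norm_starProjection_apply_le v) (by positivity)
  have hpos : 0 < 1 - β / μ := by
    rw [sub_pos, div_lt_one hμ0]
    exact hβμ
  have hXb : ‖X‖ ≤ η / (1 - β / μ) := by
    rw [le_div_iff₀ hpos]
    have : μ⁻¹ * (‖X‖ * β) = ‖X‖ * (β / μ) := by ring
    linarith
  exact (norm_starProjection_sub_le (hVd.trans hUd.symm) (norm_nonneg X) hXv).trans hXb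

end Perturbed

end Spectral

end SignalSubspace

namespace SignalSubspace

/-! ### The cosine of the minimal principal angle -/

section Angle

variable {n : ℕ} (U V : Submodule ℝ (EuclideanSpace ℝ (Fin n)))

theorem bddAbove_inner_unit :
    BddAbove {c : ℝ | ∃ x ∈ U, ∃ y ∈ V, ‖x‖ ≤ 1 ∧ ‖y‖ ≤ 1 ∧ c = inner ℝ x y} := by
  refine ⟨1, ?_⟩
  rintro c ⟨x, -, y, -, hx, hy, rfl⟩
  exact (real_inner_le_norm x y).trans (mul_le_one₀ hx (norm_nonneg _) hy)

theorem cos_minAngle :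
    Real.cos (minAngle U V) =
      sSup {c : ℝ | ∃ x ∈ U, ∃ y ∈ V, ‖x‖ ≤ 1 ∧ ‖y‖ ≤ 1 ∧ c = inner ℝ x y} := by
  have h0 : (0 : ℝ) ∈ {c : ℝ | ∃ x ∈ U, ∃ y ∈ V, ‖x‖ ≤ 1 ∧ ‖y‖ ≤ 1 ∧ c = inner ℝ x y} :=
    ⟨0, U.zero_mem, 0, V.zero_mem, by simp, by simp, by simp⟩
  refine Real.cos_arccos ?_ (csSup_le ⟨0, h0⟩ ?_)
  · linarith [le_csSup (bddAbove_inner_unit U V) h0]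
  · rintro c ⟨x, -, y, -, hx, hy, rfl⟩
    exact (real_inner_le_norm x y).trans (mul_le_one₀ hx (norm_nonneg _) hy)

theorem cos_minAngle_nonneg : 0 ≤ Real.cos (minAngle U V) := by
  rw [cos_minAngle]
  exact le_csSup (bddAbove_inner_unit U V)
    ⟨0, U.zero_mem, 0, V.zero_mem, by simp, by simp, by simp⟩

variable {U V}

theorem cos_minAngle_le {c : ℝ}
    (h : ∀ x ∈ U, ∀ y ∈ V, ‖x‖ ≤ 1 → ‖y‖ ≤ 1 → inner ℝ x y ≤ c) :
    Real.cos (minAngle U V) ≤ c := by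
  rw [cos_minAngle]
  refine csSup_le ⟨0, 0, U.zero_mem, 0, V.zero_mem, by simp, by simp, by simp⟩ ?_
  rintro _ ⟨x, hx, y, hy, hx1, hy1, rfl⟩
  exact h x hx y hy hx1 hy1

theorem inner_le_cos_minAngle {x y : EuclideanSpace ℝ (Fin n)} (hx : x ∈ U) (hy : y ∈ V) :
    inner ℝ x y ≤ ‖x‖ * ‖y‖ * Real.cos (minAngle U V) := by
  rcases eq_or_ne x 0 with rfl | hx0
  · simp
  rcases eq_or_ne y 0 with rfl | hy0
  · simp
  have hx' : 0 < ‖x‖ := norm_pos_iff.mpr hx0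
  have hy' : 0 < ‖y‖ := norm_pos_iff.mpr hy0
  have h : inner ℝ (‖x‖⁻¹ • x) (‖y‖⁻¹ • y) ≤ Real.cos (minAngle U V) := by
    rw [cos_minAngle]
    refine le_csSup (bddAbove_inner_unit U V)
      ⟨_, U.smul_mem _ hx, _, V.smul_mem _ hy, ?_, ?_, rfl⟩
    · rw [norm_smul, norm_inv, norm_norm, inv_mul_cancel₀ hx'.ne']
    · rw [norm_smul, norm_inv, norm_norm, inv_mul_cancel₀ hy'.ne']
  rw [real_inner_smul_left, real_inner_smul_right] at h
  have := mul_le_mul_of_nonneg_left h (mul_pos hx' hy').le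
  calc inner ℝ x y = ‖x‖ * ‖y‖ * (‖x‖⁻¹ * (‖y‖⁻¹ * inner ℝ x y)) := by field_simp
    _ ≤ _ := this

end Angle

/-! ### Spectral norms, singular values and the two-sided angle bound -/

section Matrices

variable {m n k : ℕ}

theorem toEuclideanLin_mul_apply (A : Matrix (Fin m) (Fin n) ℝ) (B : Matrix (Fin n) (Fin k) ℝ)
    (x : EuclideanSpace ℝ (Fin k)) :
    Matrix.toEuclideanLin (A * B) x = Matrix.toEuclideanLin A (Matrix.toEuclideanLin B x) := by
  simp [Matrix.toLpLin_apply, Matrix.mulVec_mulVec]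

theorem adjoint_toEuclideanLin (A : Matrix (Fin m) (Fin n) ℝ) :
    LinearMap.adjoint (Matrix.toEuclideanLin A) = Matrix.toEuclideanLin Aᵀ := by
  rw [← Matrix.toEuclideanLin_conjTranspose_eq_adjoint, Matrix.conjTranspose_eq_transpose_of_trivial]

theorem inner_toEuclideanLin_left (A : Matrix (Fin m) (Fin n) ℝ) (x : EuclideanSpace ℝ (Fin n))
    (y : EuclideanSpace ℝ (Fin m)) :
    inner ℝ (Matrix.toEuclideanLin A x) y = inner ℝ x (Matrix.toEuclideanLin Aᵀ y) := by
  rw [← adjoint_toEuclideanLin, LinearMap.adjoint_inner_right]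

theorem norm_toEuclideanLin_le (A : Matrix (Fin m) (Fin n) ℝ) (x : EuclideanSpace ℝ (Fin n)) :
    ‖Matrix.toEuclideanLin A x‖ ≤ ‖A‖ * ‖x‖ :=
  A.l2_opNorm_mulVec x

theorem l2_opNorm_le_of_forall {A : Matrix (Fin m) (Fin n) ℝ} {c : ℝ} (hc : 0 ≤ c)
    (h : ∀ x, ‖Matrix.toEuclideanLin A x‖ ≤ c * ‖x‖) : ‖A‖ ≤ c := by
  rw [Matrix.l2_opNorm_def]
  exact ContinuousLinearMap.opNorm_le_bound _ hc h

theorem l2_opNorm_transpose (A : Matrix (Fin m) (Fin n) ℝ) : ‖Aᵀ‖ = ‖A‖ := by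
  rw [← Matrix.conjTranspose_eq_transpose_of_trivial, Matrix.l2_opNorm_conjTranspose]

theorem l2_opNorm_self_mul_transpose (A : Matrix (Fin m) (Fin n) ℝ) : ‖A * Aᵀ‖ = ‖A‖ ^ 2 := by
  have := Matrix.l2_opNorm_conjTranspose_mul_self Aᵀ
  rwa [Matrix.conjTranspose_eq_transpose_of_trivial, Matrix.transpose_transpose,
    l2_opNorm_transpose, ← sq] at this

theorem colSpace_eq_range (M : Matrix (Fin m) (Fin n) ℝ) :
    colSpace M = LinearMap.range (Matrix.toEuclideanLin M) := by
  rw [LinearMap.range_eq_map, ← (EuclideanSpace.basisFun (Fin n) ℝ).toBasis.span_eq,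
    Submodule.map_span, ← Set.range_comp, colSpace]
  congr 2
  ext j i
  simp [Matrix.toLpLin_apply, Matrix.mulVec_single]

/-- The upper angle bound, with column spaces contained in given subspaces. -/
theorem l2_opNorm_transpose_mul_le {M₁ : Matrix (Fin m) (Fin n) ℝ} {M₂ : Matrix (Fin m) (Fin k) ℝ}
    {U V : Submodule ℝ (EuclideanSpace ℝ (Fin m))}
    (hU : LinearMap.range (Matrix.toEuclideanLin M₁) ≤ U)
    (hV : LinearMap.range (Matrix.toEuclideanLin M₂) ≤ V) :
    ‖M₁ᵀ * M₂‖ ≤ ‖M₁‖ * ‖M₂‖ * Real.cos (minAngle U V) := by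
  have hc := cos_minAngle_nonneg U V
  refine l2_opNorm_le_of_forall (by positivity) fun y => ?_
  set z := Matrix.toEuclideanLin (M₁ᵀ * M₂) y with hz
  have h1 : ‖z‖ ^ 2 = inner ℝ (Matrix.toEuclideanLin M₁ z) (Matrix.toEuclideanLin M₂ y) := by
    rw [inner_toEuclideanLin_left, ← toEuclideanLin_mul_apply, ← hz, real_inner_self_eq_norm_sq]
  have h2 := inner_le_cos_minAngle (hU ⟨z, rfl⟩) (hV ⟨y, rfl⟩)
  have h3 := mul_le_mul (norm_toEuclideanLin_le M₁ z) (norm_toEuclideanLin_le M₂ y)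
    (norm_nonneg _) (by positivity)
  have h4 := mul_le_mul_of_nonneg_right h3 hc
  rcases (norm_nonneg z).eq_or_lt with h0 | h0
  · rw [← h0]; positivity
  · exact le_of_mul_le_mul_left (by nlinarith) h0

theorem minSingularValue_nonneg (M : Matrix (Fin m) (Fin n) ℝ) : 0 ≤ minSingularValue M :=
  Real.sInf_nonneg fun _ hs => hs.1.le

/-- This is the coercivity bound for `T* T`, which has the kernel of `T` and whose eigenvalues are
the squared singular values. -/
theorem minSingularValue_mul_norm_le (M : Matrix (Fin m) (Fin n) ℝ)
    {v : EuclideanSpace ℝ (Fin n)} (hv : v ∈ (LinearMap.ker (Matrix.toEuclideanLin M))ᗮ) :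
    minSingularValue M * ‖v‖ ≤ ‖Matrix.toEuclideanLin M v‖ := by
  set T := Matrix.toEuclideanLin M with hT
  have hsym := T.isSymmetric_adjoint_comp_self
  have hker : LinearMap.ker (LinearMap.adjoint T ∘ₗ T) = LinearMap.ker T := by
    ext x
    simp only [LinearMap.mem_ker, LinearMap.comp_apply]
    refine ⟨fun h => ?_, fun h => by rw [h, map_zero]⟩
    have : inner ℝ x (LinearMap.adjoint T (T x)) = 0 := by rw [h, inner_zero_right]
    rwa [LinearMap.adjoint_inner_right, inner_self_eq_zero] at this
  have hμ : ∀ t, Module.End.HasEigenvalue (LinearMap.adjoint T ∘ₗ T) t →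
      t = 0 ∨ minSingularValue M ^ 2 ≤ t := by
    intro t ht
    obtain ⟨i, hi⟩ := hsym.exists_eigenvalues_eq rfl ht
    have hi' : T.singularValues i ^ 2 = t := by
      rw [T.sq_singularValues_fin rfl i]
      exact hi
    rcases (T.singularValues_nonneg i).eq_or_lt with h | h
    · left
      rw [← hi', ← h]
      ring
    · right
      rw [← hi']
      refine pow_le_pow_left₀ (minSingularValue_nonneg M) ?_ 2
      exact csInf_le ⟨0, fun _ hs => hs.1.le⟩ ⟨h, i, rfl⟩
  have h := mul_norm_sq_le_inner_map hsym hμ (hker.symm ▸ hv)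
  rw [LinearMap.comp_apply, LinearMap.adjoint_inner_right, real_inner_self_eq_norm_sq,
    ← mul_pow] at h
  exact le_of_sq_le_sq h (norm_nonneg _)

theorem exists_preimage_norm_le (M : Matrix (Fin m) (Fin n) ℝ) {x : EuclideanSpace ℝ (Fin m)}
    (hx : x ∈ colSpace M) :
    ∃ v, Matrix.toEuclideanLin M v = x ∧ minSingularValue M * ‖v‖ ≤ ‖x‖ := by
  rw [colSpace_eq_range] at hx
  obtain ⟨u, rfl⟩ := hx
  set N := LinearMap.ker (Matrix.toEuclideanLin M)
  have hu : Matrix.toEuclideanLin M (u - N.starProjection u) = Matrix.toEuclideanLin M u := by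
    rw [map_sub, LinearMap.mem_ker.mp (N.starProjection_apply_mem u), sub_zero]
  refine ⟨_, hu, ?_⟩
  rw [← hu]
  exact minSingularValue_mul_norm_le M (N.sub_starProjection_mem_orthogonal u)

theorem minSingularValue_mul_cos_le (M₁ : Matrix (Fin m) (Fin n) ℝ)
    (M₂ : Matrix (Fin m) (Fin k) ℝ) :
    minSingularValue M₁ * minSingularValue M₂ *
      Real.cos (minAngle (colSpace M₁) (colSpace M₂)) ≤ ‖M₁ᵀ * M₂‖ := by
  have hs₁ := minSingularValue_nonneg M₁
  have hs₂ := minSingularValue_nonneg M₂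
  -- The degenerate case covers zero matrices, where the infimum over the empty set is `0`.
  rcases (mul_nonneg hs₁ hs₂).eq_or_lt with h0 | h0
  · rw [← h0, zero_mul]
    exact norm_nonneg _
  rw [mul_comm, ← le_div_iff₀ h0]
  refine cos_minAngle_le fun x hx y hy hx1 hy1 => ?_
  obtain ⟨u, rfl, hu⟩ := exists_preimage_norm_le M₁ hx
  obtain ⟨v, rfl, hv⟩ := exists_preimage_norm_le M₂ hy
  rw [le_div_iff₀ h0, inner_toEuclideanLin_left, ← toEuclideanLin_mul_apply]
  have h1 := real_inner_le_norm u (Matrix.toEuclideanLin (M₁ᵀ * M₂) v)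
  have h2 := mul_le_mul_of_nonneg_left (norm_toEuclideanLin_le (M₁ᵀ * M₂) v) (norm_nonneg u)
  have h3 : (minSingularValue M₁ * ‖u‖) * (minSingularValue M₂ * ‖v‖) ≤ 1 :=
    mul_le_one₀ (hu.trans hx1) (by positivity) (hv.trans hy1)
  have h4 := mul_le_mul_of_nonneg_right (h1.trans h2) h0.le
  have h5 := mul_le_mul_of_nonneg_left h3 (norm_nonneg (M₁ᵀ * M₂))
  nlinarith

end Matrices

end SignalSubspace

namespace SignalSubspace

/-! ### Spectrum of `H Hᵀ` -/

section Gram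

variable {m n : ℕ} (H : Matrix (Fin m) (Fin n) ℝ)

theorem inner_toEuclideanLin_gram (v : EuclideanSpace ℝ (Fin m)) :
    inner ℝ v (Matrix.toEuclideanLin (H * Hᵀ) v) = ‖Matrix.toEuclideanLin Hᵀ v‖ ^ 2 := by
  rw [toEuclideanLin_mul_apply, ← real_inner_self_eq_norm_sq, inner_toEuclideanLin_left,
    Matrix.transpose_transpose]

theorem isSymmetric_toEuclideanLin {A : Matrix (Fin m) (Fin m) ℝ} (hA : Aᵀ = A) :
    (Matrix.toEuclideanLin A).IsSymmetric := fun x y => by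
  rw [inner_toEuclideanLin_left, hA]

theorem isPositive_toEuclideanLin_gram : (Matrix.toEuclideanLin (H * Hᵀ)).IsPositive := by
  refine ⟨isSymmetric_toEuclideanLin (by simp), fun v => ?_⟩
  rw [RCLike.re_to_real, real_inner_comm, inner_toEuclideanLin_gram]
  positivity

theorem finite_eigenvalueSet (A : Matrix (Fin m) (Fin m) ℝ) : (eigenvalueSet A).Finite :=
  Module.End.finite_hasEigenvalue _

theorem le_muMax {t : ℝ} (ht : Module.End.HasEigenvalue (Matrix.toEuclideanLin (H * Hᵀ)) t) :
    t ≤ muMax H :=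
  le_csSup (finite_eigenvalueSet _).bddAbove ht

theorem eigenvalue_eq_zero_or_muMin_le {t : ℝ}
    (ht : Module.End.HasEigenvalue (Matrix.toEuclideanLin (H * Hᵀ)) t) : t = 0 ∨ muMin H ≤ t := by
  have h0 : 0 ≤ t := eigenvalue_nonneg_of_nonneg ht fun x =>
    (isPositive_toEuclideanLin_gram H).re_inner_nonneg_right x
  rcases h0.eq_or_lt with h | h
  · exact Or.inl h.symm
  · exact Or.inr (csInf_le ⟨0, fun _ hs => hs.2.le⟩ ⟨ht, h⟩)

theorem norm_sq_le_muMax (h0 : 0 ≤ muMax H) : ‖H‖ ≤ √(muMax H) := by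
  rw [← l2_opNorm_transpose]
  refine l2_opNorm_le_of_forall (Real.sqrt_nonneg _) fun v => ?_
  refine le_of_sq_le_sq ?_ (by positivity)
  rw [← inner_toEuclideanLin_gram, mul_pow, Real.sq_sqrt h0]
  exact inner_map_le_mul_norm_sq (isPositive_toEuclideanLin_gram H).isSymmetric
    (fun t ht => le_muMax H ht) v

variable {H}

theorem exists_pos_eigenvalue (hH : H ≠ 0) :
    ∃ t, t ∈ eigenvalueSet (H * Hᵀ) ∧ 0 < t := by
  by_contra! hcon
  refine hH ?_
  have h : ‖Hᵀ‖ ≤ 0 := l2_opNorm_le_of_forall le_rfl fun v => by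
    have := inner_map_le_mul_norm_sq (isPositive_toEuclideanLin_gram H).isSymmetric
      (μ := 0) hcon v
    rw [inner_toEuclideanLin_gram] at this
    have := pow_eq_zero_iff (two_ne_zero) |>.mp
      (le_antisymm (by linarith) (sq_nonneg ‖Matrix.toEuclideanLin Hᵀ v‖))
    rw [this, zero_mul]
  rw [l2_opNorm_transpose] at h
  exact norm_le_zero_iff.mp h

/-- The spectrum is finite, so the infimum is attained at a positive eigenvalue. -/
theorem muMin_pos (hH : H ≠ 0) : 0 < muMin H := by
  obtain ⟨t, ht⟩ := exists_pos_eigenvalue hH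
  have hfin : {t | t ∈ eigenvalueSet (H * Hᵀ) ∧ 0 < t}.Finite :=
    (finite_eigenvalueSet _).subset fun _ hs => hs.1
  exact (Set.Nonempty.csInf_mem ⟨t, ht⟩ hfin).2

theorem muMax_pos (hH : H ≠ 0) : 0 < muMax H := by
  obtain ⟨t, ht, hpos⟩ := exists_pos_eigenvalue hH
  exact hpos.trans_le (le_muMax H ht)

theorem range_toEuclideanLin_gram_le :
    LinearMap.range (Matrix.toEuclideanLin (H * Hᵀ)) ≤ colSpace H := by
  rw [colSpace_eq_range]
  rintro _ ⟨v, rfl⟩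
  rw [toEuclideanLin_mul_apply]
  exact ⟨_, rfl⟩

theorem rank_eq_finrank_range_gram :
    H.rank = Module.finrank ℝ (LinearMap.range (Matrix.toEuclideanLin (H * Hᵀ))) := by
  rw [← Matrix.rank_self_mul_transpose, Matrix.rank_eq_finrank_range_toLin _
    (PiLp.basisFun 2 ℝ (Fin m)) (PiLp.basisFun 2 ℝ (Fin m))]
  simp only [Matrix.toLpLin_eq_toLin]
  congr!

theorem U0_eq_ker : U0 H = LinearMap.ker (Matrix.toEuclideanLin (H * Hᵀ)) := by
  rw [U0, Module.End.eigenspace_zero]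

end Gram

/-! ### The pseudoinverse `S₀` and the bound on `‖S₀ B(δ)‖` -/

section ReducedInverse

variable {m n : ℕ} (H : Matrix (Fin m) (Fin n) ℝ)

theorem IsPseudoinverse.transpose {M : Matrix (Fin m) (Fin n) ℝ} {X : Matrix (Fin n) (Fin m) ℝ}
    (h : IsPseudoinverse M X) : IsPseudoinverse Mᵀ Xᵀ := by
  obtain ⟨h1, h2, h3, h4⟩ := h
  refine ⟨?_, ?_, ?_, ?_⟩
  · rw [← Matrix.transpose_mul, ← Matrix.transpose_mul, ← Matrix.mul_assoc, h1]
  · rw [← Matrix.transpose_mul, ← Matrix.transpose_mul, ← Matrix.mul_assoc, h2]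
  · rw [← Matrix.transpose_mul, h4, h4]
  · rw [← Matrix.transpose_mul, h3, h3]

theorem S0_transpose : (S0 H)ᵀ = S0 H := by
  have h := isPseudoinverse_pinv (H * Hᵀ)
  have h' := h.transpose
  rw [show (H * Hᵀ)ᵀ = H * Hᵀ by simp] at h'
  exact h'.unique h

theorem S0_mul_gram_transpose : (S0 H * (H * Hᵀ))ᵀ = S0 H * (H * Hᵀ) :=
  (isPseudoinverse_pinv (H * Hᵀ)).2.2.2

theorem S0_mul_gram_comm : S0 H * (H * Hᵀ) = (H * Hᵀ) * S0 H := by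
  rw [← S0_mul_gram_transpose, Matrix.transpose_mul, S0_transpose]
  simp

theorem S0_apply_gram (v : EuclideanSpace ℝ (Fin m)) :
    Matrix.toEuclideanLin (S0 H) (Matrix.toEuclideanLin (H * Hᵀ) v) =
      (U0 H)ᗮ.starProjection v := by
  refine (Submodule.eq_starProjection_of_mem_orthogonal ?_ ?_).symm
  · rw [U0_eq_ker, ker_orthogonal_eq_range (isPositive_toEuclideanLin_gram H).isSymmetric,
      ← toEuclideanLin_mul_apply, S0_mul_gram_comm, toEuclideanLin_mul_apply]
    exact ⟨_, rfl⟩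
  · rw [Submodule.orthogonal_orthogonal, U0_eq_ker, LinearMap.mem_ker, map_sub,
      ← toEuclideanLin_mul_apply, ← toEuclideanLin_mul_apply,
      show H * Hᵀ * S0 H * (H * Hᵀ) = H * Hᵀ from (isPseudoinverse_pinv (H * Hᵀ)).1, sub_self]

theorem S0_apply_mem (v : EuclideanSpace ℝ (Fin m)) :
    Matrix.toEuclideanLin (S0 H) v ∈ LinearMap.range (Matrix.toEuclideanLin (H * Hᵀ)) := by
  have h : S0 H = H * Hᵀ * (S0 H * S0 H) := by
    rw [← Matrix.mul_assoc, ← S0_mul_gram_comm]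
    exact (isPseudoinverse_pinv (H * Hᵀ)).2.1.symm
  rw [h, toEuclideanLin_mul_apply]
  exact ⟨_, rfl⟩

variable {H}

/-- The vector `w = S₀ v` lies in `(ker HHᵀ)ᗮ` and `HHᵀ w` is the projection of `v`, so coercivity
of `HHᵀ` there, with constant `μ_min`, and Cauchy–Schwarz bound `‖w‖`. -/
theorem norm_S0_apply_le (hH : H ≠ 0) (v : EuclideanSpace ℝ (Fin m)) :
    ‖Matrix.toEuclideanLin (S0 H) v‖ ≤ (muMin H)⁻¹ * ‖(U0 H)ᗮ.starProjection v‖ := by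
  have hμ := muMin_pos hH
  have hsym := (isPositive_toEuclideanLin_gram H).isSymmetric
  set w := Matrix.toEuclideanLin (S0 H) v with hw
  have hwV : w ∈ (LinearMap.ker (Matrix.toEuclideanLin (H * Hᵀ)))ᗮ := by
    rw [ker_orthogonal_eq_range hsym]
    exact S0_apply_mem H v
  have h1 := mul_norm_sq_le_inner_map hsym (fun t ht => eigenvalue_eq_zero_or_muMin_le H ht) hwV
  have h2 : Matrix.toEuclideanLin (H * Hᵀ) w = (U0 H)ᗮ.starProjection v := by
    rw [hw, ← S0_apply_gram, ← toEuclideanLin_mul_apply, ← toEuclideanLin_mul_apply,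
      S0_mul_gram_comm]
  rw [h2] at h1
  have h3 := real_inner_le_norm w ((U0 H)ᗮ.starProjection v)
  rw [inv_mul_eq_div, le_div_iff₀ hμ]
  rcases (norm_nonneg w).eq_or_lt with h0 | h0
  · rw [← h0, zero_mul]; positivity
  · exact le_of_mul_le_mul_left (by nlinarith) h0

theorem norm_S0_le (hH : H ≠ 0) : ‖S0 H‖ ≤ (muMin H)⁻¹ := by
  have hμ := muMin_pos hH
  refine l2_opNorm_le_of_forall (by positivity) fun v => (norm_S0_apply_le hH v).trans ?_
  exact mul_le_mul_of_nonneg_left ((U0 H)ᗮ.norm_starProjection_apply_le v) (by positivity)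

theorem norm_S0_mul_pertB_le {E : Matrix (Fin m) (Fin n) ℝ} (hH : H ≠ 0) (δ : ℝ) :
    ‖S0 H * pertB H E δ‖ ≤ |δ| * (Theta1 H E * Theta2 H) *
      (2 * Real.cos (minAngle (rowSpace H) (rowSpace E)) +
        |δ| * Theta1 H E * Real.cos (minAngle (colSpace H) (colSpace E))) := by
  have hμ := muMin_pos hH
  have hM := muMax_pos hH
  set cr := Real.cos (minAngle (rowSpace H) (rowSpace E)) with hcr
  set cl := Real.cos (minAngle (colSpace H) (colSpace E)) with hcl
  have hcr0 : 0 ≤ cr := cos_minAngle_nonneg _ _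
  have hcl0 : 0 ≤ cl := cos_minAngle_nonneg _ _
  have hHn := norm_sq_le_muMax H hM.le
  have hS := norm_S0_le hH
  have hHE : ‖H * Eᵀ‖ ≤ ‖H‖ * ‖E‖ * cr := by
    have := l2_opNorm_transpose_mul_le (M₁ := Hᵀ) (M₂ := Eᵀ)
      (colSpace_eq_range Hᵀ).ge (colSpace_eq_range Eᵀ).ge
    rwa [Matrix.transpose_transpose, l2_opNorm_transpose, l2_opNorm_transpose] at this
  have hEH : ‖E * Hᵀ‖ ≤ ‖H‖ * ‖E‖ * cr := by
    have : E * Hᵀ = (H * Eᵀ)ᵀ := by simp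
    rwa [this, l2_opNorm_transpose]
  -- As `S₀` is symmetric with range inside the column space of `H`, the product `S₀ E = S₀ᵀ E` sees
  -- the column angle of `H` and `E`.
  have hSE : ‖S0 H * E‖ ≤ ‖S0 H‖ * ‖E‖ * cl := by
    have := l2_opNorm_transpose_mul_le (M₁ := S0 H) (M₂ := E) (U := colSpace H)
      (V := colSpace E) ?_ (colSpace_eq_range E).ge
    · rwa [S0_transpose] at this
    · rintro _ ⟨v, rfl⟩
      exact range_toEuclideanLin_gram_le (S0_apply_mem H v)
  have hν : nuMax E = ‖E‖ ^ 2 := l2_opNorm_self_mul_transpose E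
  set r := √(muMax H) with hr
  have hr0 : 0 < r := Real.sqrt_pos.mpr hM
  have hr2 : muMax H = r ^ 2 := (Real.sq_sqrt hM.le).symm
  -- With `μ_max = r²`, `Θ₁ Θ₂ = r ‖E‖ / μ_min` and `Θ₁² Θ₂ = ‖E‖² / μ_min`, the coefficients of the
  -- two terms.
  have hΘ1 : Theta1 H E = ‖E‖ / r := by
    rw [Theta1, hν, Real.sqrt_div (by positivity), Real.sqrt_sq (norm_nonneg _)]
  have hΘ2 : Theta2 H = r ^ 2 / muMin H := by rw [Theta2, hr2]
  have hdecomp : S0 H * pertB H E δ =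
      δ • (S0 H * (H * Eᵀ + E * Hᵀ)) + δ ^ 2 • (S0 H * E * Eᵀ) := by
    rw [pertB, Matrix.mul_add, Matrix.mul_smul, Matrix.mul_smul, Matrix.mul_assoc]
  have h1 : ‖S0 H * (H * Eᵀ + E * Hᵀ)‖ ≤ (muMin H)⁻¹ * (2 * (r * ‖E‖ * cr)) := by
    refine (Matrix.l2_opNorm_mul _ _).trans ?_
    refine mul_le_mul hS ((norm_add_le _ _).trans ?_) (norm_nonneg _) (by positivity)
    have : ‖H‖ * ‖E‖ * cr ≤ r * ‖E‖ * cr := by gcongr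
    linarith
  have h2 : ‖S0 H * E * Eᵀ‖ ≤ (muMin H)⁻¹ * ‖E‖ * cl * ‖E‖ := by
    refine (Matrix.l2_opNorm_mul _ _).trans ?_
    rw [l2_opNorm_transpose]
    refine mul_le_mul_of_nonneg_right (hSE.trans ?_) (norm_nonneg _)
    gcongr
  rw [hdecomp, hΘ1, hΘ2]
  refine (norm_add_le _ _).trans ?_
  rw [norm_smul, norm_smul, Real.norm_eq_abs, Real.norm_eq_abs, abs_pow]
  have h3 := mul_le_mul_of_nonneg_left h1 (abs_nonneg δ)
  have h4 := mul_le_mul_of_nonneg_left h2 (pow_nonneg (abs_nonneg δ) 2)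
  refine (add_le_add h3 h4).trans (le_of_eq ?_)
  field_simp

end ReducedInverse

/-! ### Leading subspaces of `A(δ)` -/

section LeadingSubspace

variable {m n : ℕ} {H E : Matrix (Fin m) (Fin n) ℝ}

theorem exists_isLeadingSubspace {A : Matrix (Fin m) (Fin m) ℝ} (hA : Aᵀ = A) (d : ℕ) :
    ∃ U, IsLeadingSubspace A d U := by
  have hsym := isSymmetric_toEuclideanLin hA
  have hn : Module.finrank ℝ (EuclideanSpace ℝ (Fin m)) = m := finrank_euclideanSpace_fin
  exact ⟨_, hsym.eigenvectorBasis hn, hsym.eigenvalues hn, hsym.eigenvalues_antitone hn,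
    hsym.apply_eigenvectorBasis hn, rfl⟩

theorem pertA_eq_add (δ : ℝ) : pertA H E δ = H * Hᵀ + pertB H E δ := by
  simp only [pertA, pertB, Matrix.transpose_add, Matrix.transpose_smul, Matrix.add_mul,
    Matrix.mul_add, Matrix.smul_mul, Matrix.mul_smul, smul_add, smul_smul, sq]
  abel

theorem toEuclideanLin_pertA_sub (δ : ℝ) :
    Matrix.toEuclideanLin (pertA H E δ) - Matrix.toEuclideanLin (H * Hᵀ) =
      Matrix.toEuclideanLin (pertB H E δ) := by
  rw [← map_sub, pertA_eq_add, add_sub_cancel_left]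

theorem abs_inner_pert_le (δ : ℝ) (v : EuclideanSpace ℝ (Fin m)) :
    |inner ℝ v ((Matrix.toEuclideanLin (pertA H E δ) - Matrix.toEuclideanLin (H * Hᵀ)) v)| ≤
      ‖pertB H E δ‖ * ‖v‖ ^ 2 := by
  rw [toEuclideanLin_pertA_sub]
  refine (abs_real_inner_le_norm _ _).trans ?_
  have := mul_le_mul_of_nonneg_left (norm_toEuclideanLin_le (pertB H E δ) v) (norm_nonneg v)
  linarith

theorem IsLeadingSubspace.unique_of_norm_pertB_lt {δ : ℝ}
    (hB : 2 * ‖pertB H E δ‖ < muMin H) {U V : Submodule ℝ (EuclideanSpace ℝ (Fin m))}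
    (hU : IsLeadingSubspace (pertA H E δ) H.rank U)
    (hV : IsLeadingSubspace (pertA H E δ) H.rank V) : U = V := by
  have hT₀ := (isPositive_toEuclideanLin_gram H).isSymmetric
  have hT := (isPositive_toEuclideanLin_gram (H + δ • E)).isSymmetric
  -- The threshold `μ_min - ‖B(δ)‖` separates the two groups of eigenvalues, and the right side
  -- mentions no eigenbasis.
  have key : ∀ W, IsLeadingSubspace (pertA H E δ) H.rank W →
      W = Submodule.span ℝ {v | ∃ t, muMin H - ‖pertB H E δ‖ ≤ t ∧
        Matrix.toEuclideanLin (pertA H E δ) v = t • v} := by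
    rintro W ⟨b, lam, hlam, hb, rfl⟩
    refine span_leading_eq hT hb (fun i hi => ?_) (fun i hi => ?_)
    · rw [rank_eq_finrank_range_gram] at hi
      have := eigenvalue_le_of_finrank_range_le hT (abs_inner_pert_le δ) hlam hb hi
      linarith
    · rw [rank_eq_finrank_range_gram] at hi
      exact le_eigenvalue_of_lt_finrank_range hT₀ hT
        (fun v hv => mul_norm_sq_le_inner_map hT₀
          (fun t ht => eigenvalue_eq_zero_or_muMin_le H ht) hv)
        (abs_inner_pert_le δ) hlam hb hi
  rw [key U hU, key V hV]

/-- The `sin θ` bound with the sharp constant, valid whenever `‖B(δ)‖ < μ_min`. -/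
theorem IsLeadingSubspace.norm_starProjection_sub_le (hH : H ≠ 0) {δ : ℝ}
    (hB : ‖pertB H E δ‖ < muMin H) {U : Submodule ℝ (EuclideanSpace ℝ (Fin m))}
    (hU : IsLeadingSubspace (pertA H E δ) H.rank U) :
    ‖U.starProjection - (U0 H)ᗮ.starProjection‖ ≤
      ‖S0 H * pertB H E δ‖ / (1 - ‖pertB H E δ‖ / muMin H) := by
  obtain ⟨b, lam, hlam, hb, rfl⟩ := hU
  have hST := S0_apply_gram H
  have hSP := norm_S0_apply_le hH
  rw [U0_eq_ker] at hST hSP ⊢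
  rw [rank_eq_finrank_range_gram]
  refine norm_starProjection_leading_sub_le (isPositive_toEuclideanLin_gram H).isSymmetric
    (isPositive_toEuclideanLin_gram (H + δ • E)) (muMin_pos hH) hB (norm_nonneg _)
    (abs_inner_pert_le δ) hlam hb hST hSP (norm_nonneg _) fun v => ?_
  have := norm_toEuclideanLin_le (S0 H * pertB H E δ) v
  rw [toEuclideanLin_mul_apply, ← toEuclideanLin_pertA_sub] at this
  exact this

end LeadingSubspace

theorem one_le_four_mul_exp_div_sqrt_pi : 1 ≤ 4 * (Real.exp (1 / 6) / √Real.pi) := by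
  have hpi : √Real.pi ≤ 2 := by
    rw [Real.sqrt_le_left (by norm_num)]
    linarith [Real.pi_le_four]
  have hpos : 0 < √Real.pi := Real.sqrt_pos.mpr Real.pi_pos
  have he : 1 ≤ Real.exp (1 / 6) := Real.one_le_exp (by norm_num)
  rw [← mul_div_assoc, le_div_iff₀ hpos]
  linarith

end SignalSubspace

theorem corollary2 {L K : ℕ} :
    -- the two-sided angle bound, for arbitrary matrices
    (∀ M₁ M₂ : Matrix (Fin L) (Fin K) ℝ,
      SignalSubspace.minSingularValue M₁ * SignalSubspace.minSingularValue M₂ *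
            Real.cos (SignalSubspace.minAngle (SignalSubspace.colSpace M₁)
              (SignalSubspace.colSpace M₂)) ≤ ‖M₁ᵀ * M₂‖ ∧
        ‖M₁ᵀ * M₂‖ ≤ ‖M₁‖ * ‖M₂‖ *
            Real.cos (SignalSubspace.minAngle (SignalSubspace.colSpace M₁)
              (SignalSubspace.colSpace M₂))) ∧
    -- the perturbation bounds
    (∀ H E : Matrix (Fin L) (Fin K) ℝ, H ≠ 0 → E ≠ 0 → H.rank < min L K →
      ∀ δ₀ : ℝ, 0 < δ₀ →
      (∀ δ : ℝ, |δ| < δ₀ → ‖SignalSubspace.pertB H E δ‖ / SignalSubspace.muMin H < 1 / 4) →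
      ∀ δ : ℝ, |δ| < δ₀ →
        (∃! U : Submodule ℝ (EuclideanSpace ℝ (Fin L)),
          SignalSubspace.IsLeadingSubspace (SignalSubspace.pertA H E δ) H.rank U) ∧
        (∀ U : Submodule ℝ (EuclideanSpace ℝ (Fin L)),
          SignalSubspace.IsLeadingSubspace (SignalSubspace.pertA H E δ) H.rank U →
          ‖U.starProjection - (SignalSubspace.U0 H)ᗮ.starProjection‖ ≤
            4 * (Real.exp (1 / 6) / √Real.pi) *
              (‖SignalSubspace.S0 H * SignalSubspace.pertB H E δ‖ /
                (1 - 4 * ‖SignalSubspace.pertB H E δ‖ / SignalSubspace.muMin H))) ∧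
        ‖SignalSubspace.S0 H * SignalSubspace.pertB H E δ‖ ≤
          |δ| * (SignalSubspace.Theta1 H E * SignalSubspace.Theta2 H) *
            (2 * Real.cos (SignalSubspace.minAngle (SignalSubspace.rowSpace H)
                (SignalSubspace.rowSpace E)) +
              |δ| * SignalSubspace.Theta1 H E *
                Real.cos (SignalSubspace.minAngle (SignalSubspace.colSpace H)
                  (SignalSubspace.colSpace E)))) := by
  refine ⟨fun M₁ M₂ => ⟨SignalSubspace.minSingularValue_mul_cos_le M₁ M₂,
    SignalSubspace.l2_opNorm_transpose_mul_le (SignalSubspace.colSpace_eq_range M₁).ge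
      (SignalSubspace.colSpace_eq_range M₂).ge⟩, ?_⟩
  intro H E hH _ _ δ₀ _ hB δ hδ
  have hμ := SignalSubspace.muMin_pos hH
  have hq := hB δ hδ
  have hB' := (div_lt_iff₀ hμ).mp hq
  have hn := norm_nonneg (SignalSubspace.pertB H E δ)
  refine ⟨?_, fun U hU => ?_, SignalSubspace.norm_S0_mul_pertB_le hH δ⟩
  · obtain ⟨U, hU⟩ := SignalSubspace.exists_isLeadingSubspace
      (A := SignalSubspace.pertA H E δ) (by simp [SignalSubspace.pertA]) H.rank
    exact ⟨U, hU, fun V hV => hV.unique_of_norm_pertB_lt (by linarith) hU⟩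
  · refine (hU.norm_starProjection_sub_le hH (by linarith)).trans ?_
    rw [mul_div_assoc]
    have hq0 : 0 ≤ ‖SignalSubspace.pertB H E δ‖ / SignalSubspace.muMin H := by positivity
    -- The sharper denominator `1 - q` is relaxed to `1 - 4q`, still positive since `q < 1/4`; the
    -- factor `4C ≥ 1` is then free.
    have h1 : ‖SignalSubspace.S0 H * SignalSubspace.pertB H E δ‖ /
          (1 - ‖SignalSubspace.pertB H E δ‖ / SignalSubspace.muMin H) ≤
        ‖SignalSubspace.S0 H * SignalSubspace.pertB H E δ‖ /
          (1 - 4 * (‖SignalSubspace.pertB H E δ‖ / SignalSubspace.muMin H)) :=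
      div_le_div_of_nonneg_left (norm_nonneg _) (by linarith) (by linarith)
    refine h1.trans (le_mul_of_one_le_left ?_ SignalSubspace.one_le_four_mul_exp_div_sqrt_pi)
    exact div_nonneg (norm_nonneg _) (by linarith)
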